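/- Let $n\in\mathbb N$, let $p\in\{0,1,2,\dots\}\cup\{\infty\}$ and let $\Omega\subseteq\mathbb C^n$ be open. Definitions. $A^p(\Omega)$ is the space of all holomorphic functions $f:\Omega\to\mathbb C$ such that $\frac{\partial^{\alpha}f}{\partial z^{\alpha}}$ extends continuously to $\overline\Omega$ for every multi-index $\alpha\in\mathbb N^n$ with $|\alpha|\le p$; its topology is given by the seminorms $|f|_{\alpha,N}=\sup_{z\in\overline\Omega,\ \|z\|\le N}\left|\frac{\partial^{\alpha}f}{\partial z^{\alpha}}(z)\right|$, $|\alpha|\le p$, $N\in\mathbb N$. A holomorphic function $f$ on $\Omega$ is holomorphically extendable at $\zeta\in\partial\Omega$ if there are $r>0$ and a holomorphic function $F$ on the open ball $B(\zeta,r)$ such that $F=f$ on some connected component of $B(\zeta,r)\cap\Omega$. The set $\Omega$ satisfies the star condition if it is open and connected and for every $\zeta\in\partial\Omega$ and every $\varepsilon>0$ there are a point $w\notin\overline\Omega$ with $\|w-\zeta\|<\varepsilon$ and a vector $v\in\mathbb C^n\setminus\{0\}$ such that the complex hyperplane $\{z\in\mathbb C^n:\langle z,v\rangle=\langle w,v\rangle\}$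 is disjoint from $\overline\Omega$. Theorem. If $\Omega$ satisfies the star condition, then: 1. For every $\zeta\in\partial\Omega$, the set of functions in $A^p(\Omega)$ that are not holomorphically extendable at $\zeta$ is a dense $G_\delta$ subset of $A^p(\Omega)$. 2. The set of functions in $A^p(\Omega)$ that are holomorphically extendable at no point of $\partial\Omega$ is a dense $G_\delta$ subset of $A^p(\Omega)$. In particular, 1 and 2 hold for every open and convex $\Omega\subseteq\mathbb C^n$. -/

import Mathlib

noncomputable section

namespace HolExt

open Set Metric Topology TopologicalSpace

/-- The space `ℂⁿ` with its Euclidean norm and its usual complex inner product. -/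
abbrev Cn (n : ℕ) : Type := EuclideanSpace ℂ (Fin n)

variable {n : ℕ}

/-- Extension by `0` to all of `ℂⁿ` of a function given on an open set `Ω`. Only its behaviour on
`Ω` (a neighbourhood of each of its points) is ever used. -/
def zeroExt (Ω : Opens (Cn n)) (f : Ω → ℂ) : Cn n → ℂ :=
  Function.extend Subtype.val f 0

/-- `f : Ω → ℂ` is holomorphic: near each point of `Ω` it is the sum of a convergent complex
power series. -/
def IsHolomorphic (Ω : Opens (Cn n)) (f : Ω → ℂ) : Prop :=
  AnalyticOnNhd ℂ (zeroExt Ω f) Ω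

/-- The complex partial derivative `∂g/∂zᵢ`. -/
def partialD (i : Fin n) (g : Cn n → ℂ) : Cn n → ℂ :=
  fun z => fderiv ℂ g z (EuclideanSpace.single i 1)

/-- The iterated partial derivative `∂^{|α|} g / ∂z₁^{α₁} ⋯ ∂zₙ^{αₙ}`. -/
def multiD (α : Fin n → ℕ) (g : Cn n → ℂ) : Cn n → ℂ :=
  (List.finRange n).foldr (fun i h => (partialD i)^[α i] h) g

/-! ### Elementary facts needed to see that `A^p(Ω)` is a vector space -/

theorem zeroExt_apply (Ω : Opens (Cn n)) (f : Ω → ℂ) (z : Ω) : zeroExt Ω f z = f z :=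
  Subtype.val_injective.extend_apply f 0 z

theorem zeroExt_add (Ω : Opens (Cn n)) (f g : Ω → ℂ) :
    zeroExt Ω (f + g) = zeroExt Ω f + zeroExt Ω g := by
  funext z
  by_cases hz : z ∈ Ω
  · have h := fun k : Ω → ℂ => zeroExt_apply Ω k ⟨z, hz⟩
    simp only at h
    simp [h]
  · have hz' : ¬ ∃ a : Ω, a.val = z := by rintro ⟨a, rfl⟩; exact hz a.2
    simp [zeroExt, Function.extend_apply' _ _ _ hz']

theorem zeroExt_smul (Ω : Opens (Cn n)) (c : ℂ) (f : Ω → ℂ) :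
    zeroExt Ω (c • f) = c • zeroExt Ω f := by
  funext z
  by_cases hz : z ∈ Ω
  · have h := fun k : Ω → ℂ => zeroExt_apply Ω k ⟨z, hz⟩
    simp only at h
    simp [h]
  · have hz' : ¬ ∃ a : Ω, a.val = z := by rintro ⟨a, rfl⟩; exact hz a.2
    simp [zeroExt, Function.extend_apply' _ _ _ hz']

theorem partialD_analytic {U : Set (Cn n)} (i : Fin n) {g : Cn n → ℂ}
    (hg : AnalyticOnNhd ℂ g U) : AnalyticOnNhd ℂ (partialD i g) U :=
  by
  intro z hz
  have h := hg.fderiv z hz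
  exact (ContinuousLinearMap.apply ℂ ℂ (EuclideanSpace.single i (1 : ℂ))).analyticAt _ |>.comp h

theorem partialD_congr {U : Set (Cn n)} (hU : IsOpen U) (i : Fin n) {g h : Cn n → ℂ}
    (e : EqOn g h U) : EqOn (partialD i g) (partialD i h) U := by
  intro z hz
  have : g =ᶠ[𝓝 z] h := Filter.eventuallyEq_of_mem (hU.mem_nhds hz) e
  simp [partialD, this.fderiv_eq]

/-- `T` maps functions analytic on `U` to such functions, and is linear on them, on `U`. -/
structure GoodOp (U : Set (Cn n)) (T : (Cn n → ℂ) → (Cn n → ℂ)) : Prop where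
  analytic : ∀ g, AnalyticOnNhd ℂ g U → AnalyticOnNhd ℂ (T g) U
  congr : ∀ g h, EqOn g h U → EqOn (T g) (T h) U
  add : ∀ g h, AnalyticOnNhd ℂ g U → AnalyticOnNhd ℂ h U → EqOn (T (g + h)) (T g + T h) U
  smul : ∀ (c : ℂ) g, AnalyticOnNhd ℂ g U → EqOn (T (c • g)) (c • T g) U

theorem GoodOp.id (U : Set (Cn n)) : GoodOp U (fun g => g) :=
  ⟨fun _ h => h, fun _ _ h => h, fun _ _ _ _ _ _ => rfl, fun _ _ _ _ _ => rfl⟩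

theorem GoodOp.comp {U : Set (Cn n)} {S T : (Cn n → ℂ) → (Cn n → ℂ)} (hS : GoodOp U S)
    (hT : GoodOp U T) : GoodOp U (fun g => S (T g)) where
  analytic g hg := hS.analytic _ (hT.analytic g hg)
  congr g h e := hS.congr _ _ (hT.congr g h e)
  add g h hg hh := (hS.congr _ _ (hT.add g h hg hh)).trans
    (hS.add _ _ (hT.analytic g hg) (hT.analytic h hh))
  smul c g hg := (hS.congr _ _ (hT.smul c g hg)).trans (hS.smul c _ (hT.analytic g hg))

theorem GoodOp.partialD {U : Set (Cn n)} (hU : IsOpen U) (i : Fin n) :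
    GoodOp U (partialD i) where
  analytic _ hg := partialD_analytic i hg
  congr _ _ e := partialD_congr hU i e
  add g h hg hh z hz := by
    simp [HolExt.partialD, fderiv_add (hg z hz).differentiableAt (hh z hz).differentiableAt]
  smul c g hg z hz := by
    simp [HolExt.partialD, fderiv_const_smul (hg z hz).differentiableAt]

theorem GoodOp.iterate {U : Set (Cn n)} {T : (Cn n → ℂ) → (Cn n → ℂ)} (hT : GoodOp U T)
    (k : ℕ) : GoodOp U (fun g => T^[k] g) := by
  induction k with
  | zero => exact GoodOp.id U
  | succ k ih => simpa [Function.iterate_succ_apply'] using hT.comp ih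

theorem GoodOp.multiD {U : Set (Cn n)} (hU : IsOpen U) (α : Fin n → ℕ) :
    GoodOp U (multiD α) := by
  unfold HolExt.multiD
  induction List.finRange n with
  | nil => exact GoodOp.id U
  | cons i l ih => exact ((GoodOp.partialD hU i).iterate (α i)).comp ih

/-- `g` extends continuously from `Ω` to the closure of `Ω`. -/
def ExtendsToClosure (Ω : Opens (Cn n)) (g : Cn n → ℂ) : Prop :=
  ∃ G : Cn n → ℂ, ContinuousOn G (closure (Ω : Set (Cn n))) ∧ EqOn G g Ω

/-- The functions of `A^p(Ω)`: the holomorphic `f : Ω → ℂ` such that `∂^α f` extends continuously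
to the closure of `Ω` for every multi-index `α` with `|α| ≤ p`. -/
def apSubmodule (p : ℕ∞) (Ω : Opens (Cn n)) : Submodule ℂ (Ω → ℂ) where
  carrier := {f | IsHolomorphic Ω f ∧
    ∀ α : Fin n → ℕ, ((∑ i, α i : ℕ) : ℕ∞) ≤ p → ExtendsToClosure Ω (multiD α (zeroExt Ω f))}
  zero_mem' := by
    have h0 : zeroExt Ω 0 = 0 := by simpa using zeroExt_smul Ω 0 0
    refine ⟨?_, fun α _ => ⟨0, continuousOn_const, ?_⟩⟩
    · rw [IsHolomorphic, h0]
      exact fun z _ => analyticAt_const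
    · rw [h0]
      have := (GoodOp.multiD Ω.isOpen α).smul 0 0 (fun z _ => analyticAt_const)
      intro z hz
      simpa using (this hz).symm
  add_mem' := by
    rintro f g ⟨hf, hf'⟩ ⟨hg, hg'⟩
    refine ⟨?_, fun α hα => ?_⟩
    · rw [IsHolomorphic, zeroExt_add]
      exact fun z hz => (hf z hz).add (hg z hz)
    · obtain ⟨F, hF, eF⟩ := hf' α hα
      obtain ⟨G, hG, eG⟩ := hg' α hα
      refine ⟨F + G, hF.add hG, fun z hz => ?_⟩
      rw [zeroExt_add, (GoodOp.multiD Ω.isOpen α).add _ _ hf hg hz]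
      simp [eF hz, eG hz]
  smul_mem' := by
    rintro c f ⟨hf, hf'⟩
    refine ⟨?_, fun α hα => ?_⟩
    · rw [IsHolomorphic, zeroExt_smul]
      exact fun z hz => (hf z hz).const_smul
    · obtain ⟨F, hF, eF⟩ := hf' α hα
      refine ⟨c • F, hF.const_smul c, fun z hz => ?_⟩
      rw [zeroExt_smul, (GoodOp.multiD Ω.isOpen α).smul c _ hf hz]
      simp [eF hz]

/-- The space `A^p(Ω)`, as a type of its own (so that it does not carry the topology of pointwise
convergence). -/
def Ap (p : ℕ∞) (Ω : Opens (Cn n)) : Type := ↥(apSubmodule p Ω)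

instance (p : ℕ∞) (Ω : Opens (Cn n)) : AddCommGroup (Ap p Ω) :=
  inferInstanceAs (AddCommGroup ↥(apSubmodule p Ω))

instance (p : ℕ∞) (Ω : Opens (Cn n)) : Module ℂ (Ap p Ω) :=
  inferInstanceAs (Module ℂ ↥(apSubmodule p Ω))

/-- The function `Ω → ℂ` underlying an element of `A^p(Ω)`. -/
def Ap.toFun {p : ℕ∞} {Ω : Opens (Cn n)} (f : Ap p Ω) : Ω → ℂ := f.1

/-- The multi-indices `α ∈ ℕⁿ` with `|α| ≤ p`. -/
abbrev MultiIdx (n : ℕ) (p : ℕ∞) : Type := {α : Fin n → ℕ // ((∑ i, α i : ℕ) : ℕ∞) ≤ p}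

/-- The continuous extension of `∂^α f` to the closure of `Ω`. -/
def Ap.derivExt {p : ℕ∞} {Ω : Opens (Cn n)} (α : MultiIdx n p) (f : Ap p Ω) : Cn n → ℂ :=
  extendFrom Ω (multiD α.1 (zeroExt Ω f.toFun))

theorem extendFrom_eqOn {Ω : Opens (Cn n)} {g G : Cn n → ℂ}
    (hG : ContinuousOn G (closure (Ω : Set (Cn n)))) (e : EqOn G g Ω) :
    EqOn (extendFrom Ω g) G (closure (Ω : Set (Cn n))) := by
  intro z hz
  refine extendFrom_eq hz ?_
  refine ((hG z hz).mono subset_closure).tendsto.congr' ?_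
  exact Filter.eventuallyEq_of_mem self_mem_nhdsWithin e

theorem Ap.derivExt_continuousOn {p : ℕ∞} {Ω : Opens (Cn n)} (α : MultiIdx n p) (f : Ap p Ω) :
    ContinuousOn (f.derivExt α) (closure (Ω : Set (Cn n))) := by
  obtain ⟨G, hG, e⟩ := f.2.2 α.1 α.2
  exact hG.congr (extendFrom_eqOn hG e)

theorem Ap.derivExt_eqOn {p : ℕ∞} {Ω : Opens (Cn n)} (α : MultiIdx n p) (f : Ap p Ω) :
    EqOn (f.derivExt α) (multiD α.1 (zeroExt Ω f.toFun)) Ω := by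
  obtain ⟨G, hG, e⟩ := f.2.2 α.1 α.2
  exact ((extendFrom_eqOn hG e).mono subset_closure).trans e

theorem Ap.derivExt_add {p : ℕ∞} {Ω : Opens (Cn n)} (α : MultiIdx n p) (f g : Ap p Ω) :
    EqOn ((f + g).derivExt α) (f.derivExt α + g.derivExt α) (closure (Ω : Set (Cn n))) := by
  refine extendFrom_eqOn ((f.derivExt_continuousOn α).add (g.derivExt_continuousOn α)) ?_
  intro z hz
  have : (f + g).toFun = f.toFun + g.toFun := rfl
  rw [this, zeroExt_add, (GoodOp.multiD Ω.isOpen α.1).add (zeroExt Ω f.toFun) (zeroExt Ω g.toFun)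
    f.2.1 g.2.1 hz]
  simp [f.derivExt_eqOn α hz, g.derivExt_eqOn α hz]

theorem Ap.derivExt_smul {p : ℕ∞} {Ω : Opens (Cn n)} (α : MultiIdx n p) (c : ℂ) (f : Ap p Ω) :
    EqOn ((c • f).derivExt α) (c • f.derivExt α) (closure (Ω : Set (Cn n))) := by
  refine extendFrom_eqOn ((f.derivExt_continuousOn α).const_smul c) ?_
  intro z hz
  have : (c • f).toFun = c • f.toFun := rfl
  rw [this, zeroExt_smul, (GoodOp.multiD Ω.isOpen α.1).smul c (zeroExt Ω f.toFun) f.2.1 hz]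
  simp [f.derivExt_eqOn α hz]

theorem Ap.bddAbove {p : ℕ∞} {Ω : Opens (Cn n)} (α : MultiIdx n p) (N : ℕ) (f : Ap p Ω) :
    BddAbove (range fun z : ↥(closure (Ω : Set (Cn n)) ∩ closedBall 0 (N : ℝ)) =>
      ‖f.derivExt α z‖) := by
  have hK : IsCompact (closure (Ω : Set (Cn n)) ∩ closedBall 0 (N : ℝ)) :=
    (isCompact_closedBall 0 (N : ℝ)).inter_left isClosed_closure
  have := hK.bddAbove_image (((f.derivExt_continuousOn α).mono inter_subset_left).norm)
  rwa [image_eq_range] at this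

/-- The seminorm `|f|_{α,N} = sup {|∂^α f(z)| : z ∈ closure Ω, ‖z‖ ≤ N}`, for `|α| ≤ p`. -/
def apSeminorm (p : ℕ∞) (Ω : Opens (Cn n)) (α : MultiIdx n p) (N : ℕ) : Seminorm ℂ (Ap p Ω) :=
  Seminorm.of
    (fun f => ⨆ z : ↥(closure (Ω : Set (Cn n)) ∩ closedBall 0 (N : ℝ)), ‖f.derivExt α z‖)
    (by
      intro f g
      refine Real.iSup_le (fun z => ?_) (add_nonneg (Real.iSup_nonneg fun _ => norm_nonneg _)
        (Real.iSup_nonneg fun _ => norm_nonneg _))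
      rw [Ap.derivExt_add α f g z.2.1]
      exact (norm_add_le _ _).trans
        (add_le_add (le_ciSup (f.bddAbove α N) z) (le_ciSup (g.bddAbove α N) z)))
    (by
      intro c f
      rw [Real.mul_iSup_of_nonneg (norm_nonneg c)]
      refine iSup_congr fun z => ?_
      rw [Ap.derivExt_smul α c f z.2.1]
      simp)

/-- The family of all seminorms `|·|_{α,N}`, `|α| ≤ p`, `N ∈ ℕ`. -/
def apFamily (p : ℕ∞) (Ω : Opens (Cn n)) : SeminormFamily ℂ (Ap p Ω) (MultiIdx n p × ℕ) :=
  fun i => apSeminorm p Ω i.1 i.2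

/-- The topology of `A^p(Ω)` is the one given by the seminorms `|·|_{α,N}`. -/
instance (p : ℕ∞) (Ω : Opens (Cn n)) : TopologicalSpace (Ap p Ω) :=
  (apFamily p Ω).moduleFilterBasis.topology

theorem apFamily_withSeminorms (p : ℕ∞) (Ω : Opens (Cn n)) : WithSeminorms (apFamily p Ω) :=
  ⟨rfl⟩

/-- `f : Ω → ℂ` is holomorphically extendable at `ζ`: there are a ball `B(ζ, r)` and a holomorphic
function `F` on it that agrees with `f` on some connected component of `B(ζ, r) ∩ Ω`. -/
def ExtendableAt {Ω : Opens (Cn n)} (f : Ω → ℂ) (ζ : Cn n) : Prop :=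
  ∃ r > 0, ∃ F : Cn n → ℂ, AnalyticOnNhd ℂ F (ball ζ r) ∧
    ∃ x ∈ ball ζ r ∩ (Ω : Set (Cn n)),
      ∀ z : Ω, (z : Cn n) ∈ connectedComponentIn (ball ζ r ∩ (Ω : Set (Cn n))) x → F z = f z

/-- The complex hyperplane `{z : ⟨z, v⟩ = ⟨w, v⟩}` through `w`. (Mathlib's inner product is
linear in its second argument.) -/
def hyperplane (w v : Cn n) : Set (Cn n) := {z | inner ℂ v z = inner ℂ v w}

/-- The star condition. -/
def StarCondition (Ω : Opens (Cn n)) : Prop :=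
  IsPreconnected (Ω : Set (Cn n)) ∧
    ∀ ζ ∈ frontier (Ω : Set (Cn n)), ∀ ε > 0,
      ∃ w ∈ ball ζ ε, w ∉ closure (Ω : Set (Cn n)) ∧
        ∃ v : Cn n, v ≠ 0 ∧ Disjoint (hyperplane w v) (closure (Ω : Set (Cn n)))

/-- The functions of `A^p(Ω)` that are not holomorphically extendable at `ζ`. -/
def nonExtendableAt (p : ℕ∞) (Ω : Opens (Cn n)) (ζ : Cn n) : Set (Ap p Ω) :=
  {f | ¬ ExtendableAt f.toFun ζ}

/-- The functions of `A^p(Ω)` that are holomorphically extendable at no boundary point. -/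
def nonExtendable (p : ℕ∞) (Ω : Opens (Cn n)) : Set (Ap p Ω) :=
  {f | ∀ ζ ∈ frontier (Ω : Set (Cn n)), ¬ ExtendableAt f.toFun ζ}

end HolExt

end

/-! Baire's theorem in the Fréchet space `Ap p Ω`. For a ball meeting `∂Ω`, a component of its
intersection with `Ω`, and a bound `M`, consider the functions agreeing on that component with a
holomorphic function on the ball bounded by `M`. This set is closed by Montel's theorem
(`isClosed_boundedlyExtendable`). It has empty interior: the star condition puts in the ball a point
`w` of a complex hyperplane missing `closure Ω`, and the reciprocal `g` of its affine equation lies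
in `Ap p Ω` but has a pole at `w`. If `f` and `f + t • g` with `t ≠ 0` both extended, so would `g`.

Shrinking balls makes every extension bounded, and rational radii and a dense sequence reduce to
countably many such sets, whose union is the set of extendable functions. Convex sets satisfy the
star condition by Hahn–Banach. -/

noncomputable section

namespace HolExt

open Set Metric Topology TopologicalSpace Filter

/-! ### Cauchy estimates and Taylor series in several variables -/

section SeveralVariables

variable {E G : Type*} [NormedAddCommGroup E] [NormedSpace ℂ E]
  [NormedAddCommGroup G] [NormedSpace ℂ G]

/-- Schwarz lemma: `F` maps the ball into the closed ball of radius `2M` about `F c`. -/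
theorem norm_fderiv_le_of_norm_le {F : E → G} {c : E} {δ M : ℝ} (hδ : 0 < δ)
    (hF : DifferentiableOn ℂ F (ball c δ)) (hM : ∀ z ∈ ball c δ, ‖F z‖ ≤ M) :
    ‖fderiv ℂ F c‖ ≤ M * (2 / δ) := by
  have h := Complex.norm_fderiv_le_div_of_mapsTo_ball (R₂ := M + M) hF (fun z hz => by
    rw [mem_closedBall, dist_eq_norm]
    exact (norm_sub_le _ _).trans (add_le_add (hM z hz) (hM c (mem_ball_self hδ)))) hδ
  refine h.trans_eq ?_
  ring

/-- Iterated Cauchy estimates: each derivative costs a shrinking of the ball by `δ`. -/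
theorem norm_iteratedFDeriv_le_of_norm_le [CompleteSpace G] {F : E → G} {c : E} {ρ δ M : ℝ}
    (hδ : 0 < δ) (hF : AnalyticOnNhd ℂ F (ball c ρ)) (hM : ∀ z ∈ ball c ρ, ‖F z‖ ≤ M) (k : ℕ) :
    ∀ z ∈ ball c (ρ - k * δ), ‖iteratedFDeriv ℂ k F z‖ ≤ M * (2 / δ) ^ k := by
  induction k with
  | zero => simpa using hM
  | succ k ih =>
    intro z hz
    have hsub : ball z δ ⊆ ball c (ρ - k * δ) := by
      refine ball_subset_ball' ?_
      rw [mem_ball] at hz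
      push_cast at hz
      linarith
    have hsub' : ball c (ρ - k * δ) ⊆ ball c ρ := ball_subset_ball (by
      have : 0 ≤ k * δ := by positivity
      linarith)
    rw [← norm_fderiv_iteratedFDeriv, pow_succ, ← mul_assoc]
    exact norm_fderiv_le_of_norm_le hδ
      ((hF.iteratedFDeriv k).differentiableOn.mono (hsub.trans hsub')) fun w hw => ih w (hsub hw)

/-- The Taylor series at `c`, as a formal multilinear series. -/
def taylor (F : E → G) (c : E) : FormalMultilinearSeries ℂ E G :=
  fun k => (k.factorial : ℂ)⁻¹ • iteratedFDeriv ℂ k F c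

/-- Spreading `k` differentiations over half the radius, in steps `ρ / (2k)`, gives `(4k/ρ)^k`; then
`k^k / k! ≤ e^k ≤ 3^k` yields `12 = 4 * 3`. -/
theorem norm_taylor_le [CompleteSpace G] {F : E → G} {c : E} {ρ M : ℝ}
    (hρ : 0 < ρ) (hF : AnalyticOnNhd ℂ F (ball c ρ)) (hM : ∀ z ∈ ball c ρ, ‖F z‖ ≤ M) (k : ℕ) :
    ‖taylor F c k‖ ≤ M * (12 / ρ) ^ k := by
  have hM0 : 0 ≤ M := (norm_nonneg _).trans (hM c (mem_ball_self hρ))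
  rcases Nat.eq_zero_or_pos k with rfl | hk
  · simpa [taylor] using hM c (mem_ball_self hρ)
  have hk' : (0 : ℝ) < k := by exact_mod_cast hk
  have h := norm_iteratedFDeriv_le_of_norm_le (δ := ρ / (2 * k)) (by positivity) hF hM k c
    (mem_ball_self (by
      have : (k : ℝ) * (ρ / (2 * k)) = ρ / 2 := by field_simp
      rw [this]; linarith))
  have hf : (0 : ℝ) < k.factorial := by exact_mod_cast k.factorial_pos
  have he : (k : ℝ) ^ k / k.factorial ≤ 3 ^ k := by
    refine (Real.pow_div_factorial_le_exp _ hk'.le k).trans ?_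
    rw [← mul_one (k : ℝ), Real.exp_nat_mul]
    exact pow_le_pow_left₀ (Real.exp_pos _).le (Real.exp_one_lt_d9.le.trans (by norm_num)) k
  rw [taylor, norm_smul, norm_inv, RCLike.norm_natCast]
  calc (k.factorial : ℝ)⁻¹ * ‖iteratedFDeriv ℂ k F c‖
      ≤ (k.factorial : ℝ)⁻¹ * (M * (2 / (ρ / (2 * k))) ^ k) := by gcongr
    _ = M * (4 / ρ) ^ k * ((k : ℝ) ^ k / k.factorial) := by
        have : 2 / (ρ / (2 * k)) = 4 / ρ * k := by field_simp; norm_num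
        rw [this, mul_pow]; ring
    _ ≤ M * (4 / ρ) ^ k * 3 ^ k := by gcongr
    _ = M * (12 / ρ) ^ k := by rw [mul_assoc, ← mul_pow]; congr 2; ring

theorem le_radius_of_norm_le_geometric {p : FormalMultilinearSeries ℂ E G} {ρ M : ℝ} (hρ : 0 < ρ)
    (hp : ∀ k, ‖p k‖ ≤ M * (12 / ρ) ^ k) : ENNReal.ofReal (ρ / 12) ≤ p.radius := by
  refine p.le_radius_of_bound M (r := (ρ / 12).toNNReal) fun k => ?_
  rw [Real.coe_toNNReal _ (by positivity)]
  calc ‖p k‖ * (ρ / 12) ^ k ≤ M * (12 / ρ) ^ k * (ρ / 12) ^ k := by gcongr; exact hp k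
    _ = M := by
      rw [mul_assoc, ← mul_pow]
      have : 12 / ρ * (ρ / 12) = 1 := by field_simp
      rw [this]; simp

/-- A bounded holomorphic function on a ball is the sum of its Taylor series on a ball whose
radius is a fixed proportion of the given one. -/
theorem hasFPowerSeriesOnBall_taylor [CompleteSpace G] {F : E → G} {c : E} {ρ M : ℝ}
    (hρ : 0 < ρ) (hF : AnalyticOnNhd ℂ F (ball c ρ)) (hM : ∀ z ∈ ball c ρ, ‖F z‖ ≤ M) :
    HasFPowerSeriesOnBall F (taylor F c) c (ENNReal.ofReal (ρ / 12)) := by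
  have hr := le_radius_of_norm_le_geometric hρ (norm_taylor_le hρ hF hM)
  have hr0 : 0 < ENNReal.ofReal (ρ / 12) := by
    rw [ENNReal.ofReal_pos]; positivity
  have hs := ((taylor F c).hasFPowerSeriesOnBall (hr0.trans_le hr)).mono hr0 hr
  have hs' := hs.comp_sub c
  rw [zero_add] at hs'
  refine hs'.congr ?_
  rw [eball_ofReal]
  have hsub : ball c (ρ / 12) ⊆ ball c ρ := ball_subset_ball (by linarith)
  -- Near `c` any power series of `F` sums the same Taylor terms; the identity theorem carries the
  -- equality to the whole smaller ball.
  refine AnalyticOnNhd.eqOn_of_preconnected_of_eventuallyEq (z₀ := c) ?_ (hF.mono hsub)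
    (convex_ball c _).isPreconnected (mem_ball_self (by positivity)) ?_
  · have := hs'.analyticOnNhd
    rwa [eball_ofReal] at this
  obtain ⟨q, r, hq⟩ := hF c (mem_ball_self hρ)
  filter_upwards [Metric.eball_mem_nhds c hq.r_pos, Metric.eball_mem_nhds c hr0] with z hz hz'
  have h1 := hq.hasSum_iteratedFDeriv (y := z - c) (by simpa [edist_eq_enorm_sub] using hz)
  have h2 := hs'.hasSum (y := z - c) (by simpa [dist_eq_norm] using hz')
  rw [add_sub_cancel] at h1 h2
  exact h2.unique h1

end SeveralVariables

/-! ### Locally bounded limits of holomorphic functions -/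

section Limits

variable {E ι : Type*} [NormedAddCommGroup E] [NormedSpace ℂ E]

/-- Along `l`, the functions `Fs i` are holomorphic on `U`, locally bounded there, and converge
pointwise on `U` to `F`. -/
structure LocallyBoundedLimit (l : Filter ι) (Fs : ι → E → ℂ) (F : E → ℂ) (U : Set E) : Prop where
  analytic : ∀ᶠ i in l, AnalyticOnNhd ℂ (Fs i) U
  bounded : ∀ z ∈ U, ∃ ρ > 0, ∃ M, ∀ᶠ i in l, ∀ w ∈ ball z ρ, ‖Fs i w‖ ≤ M
  tendsto : ∀ z ∈ U, Tendsto (fun i => Fs i z) l (𝓝 (F z))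

namespace LocallyBoundedLimit

variable {l : Filter ι} {Fs : ι → E → ℂ} {F : E → ℂ} {U : Set E}

theorem exists_ball (h : LocallyBoundedLimit l Fs F U) (hU : IsOpen U) {z : E} (hz : z ∈ U) :
    ∃ ρ > 0, ball z ρ ⊆ U ∧ ∃ M, ∀ᶠ i in l, ∀ w ∈ ball z ρ, ‖Fs i w‖ ≤ M := by
  obtain ⟨ρ, hρ, M, hM⟩ := h.bounded z hz
  obtain ⟨ε, hε, hεU⟩ := Metric.isOpen_iff.1 hU z hz
  refine ⟨min ρ ε, lt_min hρ hε, (ball_subset_ball (min_le_right _ _)).trans hεU, M, ?_⟩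
  filter_upwards [hM] with i hi w hw using hi w (ball_subset_ball (min_le_left _ _) hw)

end LocallyBoundedLimit

variable [FiniteDimensional ℂ E]

/-- Makes closed balls of Taylor coefficients compact. -/
instance finiteDimensional_continuousMultilinearMap (k : ℕ) :
    FiniteDimensional ℂ (ContinuousMultilinearMap ℂ (fun _ : Fin k => E) ℂ) :=
  FiniteDimensional.of_injective
    (ContinuousMultilinearMap.toMultilinearMapLinear :
      ContinuousMultilinearMap ℂ (fun _ : Fin k => E) ℂ →ₗ[ℂ] _)
    ContinuousMultilinearMap.toMultilinearMap_injective

/-- Pointwise limits of uniformly bounded holomorphic functions on a ball are holomorphic at the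
centre, and the derivatives at the centre converge. -/
theorem analyticAt_and_tendsto_fderiv_of_bounded {u : Ultrafilter ι} {Fs : ι → E → ℂ} {F : E → ℂ}
    {c : E} {ρ M : ℝ} (hρ : 0 < ρ) (ha : ∀ᶠ i in u, AnalyticOnNhd ℂ (Fs i) (ball c ρ))
    (hM : ∀ᶠ i in u, ∀ z ∈ ball c ρ, ‖Fs i z‖ ≤ M)
    (hlim : ∀ z ∈ ball c ρ, Tendsto (fun i => Fs i z) u (𝓝 (F z))) :
    AnalyticAt ℂ F c ∧ Tendsto (fun i => fderiv ℂ (Fs i) c) u (𝓝 (fderiv ℂ F c)) := by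
  have hp : ∀ᶠ i in u, HasFPowerSeriesOnBall (Fs i) (taylor (Fs i) c) c (ENNReal.ofReal (ρ / 12)) ∧
      ∀ k, ‖taylor (Fs i) c k‖ ≤ M * (12 / ρ) ^ k := by
    filter_upwards [ha, hM] with i h1 h2
    exact ⟨hasFPowerSeriesOnBall_taylor hρ h1 h2, norm_taylor_le hρ h1 h2⟩
  -- By compactness each coefficient converges along the ultrafilter, so no diagonal extraction is
  -- needed.
  have hP : ∀ k, ∃ P : ContinuousMultilinearMap ℂ (fun _ : Fin k => E) ℂ,
      ‖P‖ ≤ M * (12 / ρ) ^ k ∧ Tendsto (fun i => taylor (Fs i) c k) u (𝓝 P) := by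
    intro k
    have := FiniteDimensional.proper ℂ (ContinuousMultilinearMap ℂ (fun _ : Fin k => E) ℂ)
    obtain ⟨P, hP, hP'⟩ := (isCompact_closedBall (0 : ContinuousMultilinearMap ℂ
      (fun _ : Fin k => E) ℂ) (M * (12 / ρ) ^ k)).ultrafilter_le_nhds
      (u.map fun i => taylor (Fs i) c k) (by
        rw [le_principal_iff, Ultrafilter.mem_coe, Ultrafilter.mem_map]
        change ∀ᶠ i in (u : Filter ι), _
        filter_upwards [hp] with i hi
        simpa using hi.2 k)
    exact ⟨P, by simpa using hP, hP'⟩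
  choose P hPb hPt using hP
  have hr := le_radius_of_norm_le_geometric (p := P) hρ hPb
  have hps : HasFPowerSeriesOnBall F P c (ENNReal.ofReal (ρ / 12)) := by
    refine ⟨hr, by rw [ENNReal.ofReal_pos]; positivity, fun {y} hy => ?_⟩
    rw [eball_ofReal, mem_ball_zero_iff] at hy
    have hy' : ‖y‖ < ρ := by linarith
    have hsum : Summable fun k => M * (12 / ρ * ‖y‖) ^ k := by
      refine (summable_geometric_of_lt_one (by positivity) ?_).mul_left M
      rw [div_mul_eq_mul_div, div_lt_one hρ]
      linarith
    have hterm : ∀ (Q : FormalMultilinearSeries ℂ E ℂ) (k : ℕ), ‖Q k‖ ≤ M * (12 / ρ) ^ k →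
        ‖Q k fun _ => y‖ ≤ M * (12 / ρ * ‖y‖) ^ k := fun Q k hQ => by
      refine ((Q k).le_opNorm _).trans ?_
      rw [Finset.prod_const, Finset.card_univ, Fintype.card_fin, mul_pow, ← mul_assoc]
      gcongr
    -- For `‖y‖ < ρ / 12` the majorant is a geometric series independent of `i`.
    have htend := tendsto_tsum_of_dominated_convergence (𝓕 := (u : Filter ι))
      (f := fun i k => taylor (Fs i) c k fun _ => y) (g := fun k => P k fun _ => y) hsum
      (fun k => ((ContinuousMultilinearMap.apply ℂ (fun _ : Fin k => E) ℂ
        (fun _ => y)).continuous.tendsto _).comp (hPt k))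
      (by filter_upwards [hp] with i hi k using hterm _ k (hi.2 k))
    have hFs : Tendsto (fun i => ∑' k, taylor (Fs i) c k fun _ => y) u (𝓝 (F (c + y))) := by
      refine (hlim (c + y) (by simpa using hy')).congr' ?_
      filter_upwards [hp] with i hi
      exact (hi.1.hasSum (by rwa [eball_ofReal, mem_ball_zero_iff])).tsum_eq.symm
    rw [tendsto_nhds_unique hFs htend]
    exact (Summable.of_norm_bounded hsum fun k => hterm P k (hPb k)).hasSum
  refine ⟨hps.analyticAt, ?_⟩
  rw [hps.hasFPowerSeriesAt.fderiv_eq]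
  refine (((continuousMultilinearCurryFin1 ℂ E ℂ).continuous.tendsto _).comp (hPt 1)).congr' ?_
  filter_upwards [hp] with i hi
  exact hi.1.hasFPowerSeriesAt.fderiv_eq.symm

namespace LocallyBoundedLimit

variable {l : Filter ι} {Fs : ι → E → ℂ} {F : E → ℂ} {U : Set E}

theorem analyticAt_and_tendsto_fderiv (h : LocallyBoundedLimit l Fs F U) (hU : IsOpen U)
    {u : Ultrafilter ι} (hu : ↑u ≤ l) {z : E} (hz : z ∈ U) :
    AnalyticAt ℂ F z ∧ Tendsto (fun i => fderiv ℂ (Fs i) z) u (𝓝 (fderiv ℂ F z)) := by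
  obtain ⟨ρ, hρ, hsub, M, hM⟩ := h.exists_ball hU hz
  exact analyticAt_and_tendsto_fderiv_of_bounded hρ
    (hu (h.analytic.mono fun i hi => hi.mono hsub)) (hu hM)
    fun w hw => (h.tendsto w (hsub hw)).mono_left hu

theorem analyticOnNhd [l.NeBot] (h : LocallyBoundedLimit l Fs F U) (hU : IsOpen U) :
    AnalyticOnNhd ℂ F U := fun _ hz =>
  (h.analyticAt_and_tendsto_fderiv hU (Ultrafilter.of_le l) hz).1

/-- Along every ultrafilter finer than `l` the limit is the same, namely `fderiv ℂ F z`. -/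
theorem tendsto_fderiv (h : LocallyBoundedLimit l Fs F U) (hU : IsOpen U) {z : E} (hz : z ∈ U) :
    Tendsto (fun i => fderiv ℂ (Fs i) z) l (𝓝 (fderiv ℂ F z)) := by
  rw [tendsto_iff_ultrafilter]
  exact fun u hu => (h.analyticAt_and_tendsto_fderiv hU hu hz).2

end LocallyBoundedLimit

end Limits

namespace LocallyBoundedLimit

variable {n : ℕ} {ι : Type*} {l : Filter ι} {Fs : ι → Cn n → ℂ} {F : Cn n → ℂ} {U : Set (Cn n)}

/-- Cauchy's estimate on balls of half the radius preserves local boundedness, so the step can be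
iterated. -/
theorem partialD (h : LocallyBoundedLimit l Fs F U) (hU : IsOpen U) (j : Fin n) :
    LocallyBoundedLimit l (fun i => partialD j (Fs i)) (partialD j F) U where
  analytic := h.analytic.mono fun _ hi => partialD_analytic j hi
  bounded z hz := by
    obtain ⟨ρ, hρ, hsub, M, hM⟩ := h.exists_ball hU hz
    refine ⟨ρ / 2, by positivity, M * (2 / (ρ / 2)), ?_⟩
    filter_upwards [hM, h.analytic] with i hi ha w hw
    have hwz : ball w (ρ / 2) ⊆ ball z ρ := ball_subset_ball' (by
      rw [mem_ball] at hw; linarith)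
    have := norm_fderiv_le_of_norm_le (by positivity)
      (ha.differentiableOn.mono (hwz.trans hsub)) fun v hv => hi v (hwz hv)
    refine ((fderiv ℂ (Fs i) w).le_opNorm _).trans ?_
    simpa using this
  tendsto z hz := ((ContinuousLinearMap.apply ℂ ℂ
    (EuclideanSpace.single j (1 : ℂ))).continuous.tendsto _).comp (h.tendsto_fderiv hU hz)

theorem multiD (h : LocallyBoundedLimit l Fs F U) (hU : IsOpen U) (α : Fin n → ℕ) :
    LocallyBoundedLimit l (fun i => multiD α (Fs i)) (multiD α F) U := by
  unfold HolExt.multiD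
  induction List.finRange n with
  | nil => exact h
  | cons j L ih =>
    simp only [List.foldr_cons]
    induction α j with
    | zero => exact ih
    | succ k ihk => simpa only [Function.iterate_succ_apply'] using ihk.partialD hU j

end LocallyBoundedLimit

/-! ### Completeness of `A^p(Ω)` -/

variable {n : ℕ} {p : ℕ∞} {Ω : Opens (Cn n)}

theorem multiD_zero (g : Cn n → ℂ) : multiD 0 g = g := by
  unfold multiD
  induction List.finRange n with
  | nil => rfl
  | cons i L ih => simp

theorem multiD_eqOn {U : Set (Cn n)} (hU : IsOpen U) (α : Fin n → ℕ) {g h : Cn n → ℂ}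
    (e : EqOn g h U) : EqOn (multiD α g) (multiD α h) U :=
  (GoodOp.multiD hU α).congr g h e

theorem zeroExt_restrict_eqOn (Ω : Opens (Cn n)) (G : Cn n → ℂ) :
    EqOn (zeroExt Ω fun z => G z) G Ω :=
  fun z hz => zeroExt_apply Ω _ ⟨z, hz⟩

/-- The multi-index `0`. -/
def MultiIdx.zero (n : ℕ) (p : ℕ∞) : MultiIdx n p := ⟨0, by simp⟩

namespace Ap

theorem derivExt_sub (α : MultiIdx n p) (f g : Ap p Ω) :
    EqOn ((f - g).derivExt α) (f.derivExt α - g.derivExt α) (closure (Ω : Set (Cn n))) := by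
  intro z hz
  rw [sub_eq_add_neg, ← neg_one_smul ℂ g, derivExt_add α f _ hz, Pi.add_apply,
    derivExt_smul α (-1) g hz]
  simp [sub_eq_add_neg]

theorem derivExt_zero_apply (f : Ap p Ω) (z : Ω) : f.derivExt (MultiIdx.zero n p) z = f.toFun z := by
  rw [f.derivExt_eqOn _ z.2, MultiIdx.zero, multiD_zero, zeroExt_apply]

theorem norm_derivExt_le (α : MultiIdx n p) (N : ℕ) (f : Ap p Ω) {z : Cn n}
    (hz : z ∈ closure (Ω : Set (Cn n))) (hN : ‖z‖ ≤ N) :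
    ‖f.derivExt α z‖ ≤ apSeminorm p Ω α N f :=
  le_ciSup (f.bddAbove α N) ⟨z, hz, by simpa using hN⟩

theorem apSeminorm_le {α : MultiIdx n p} {N : ℕ} {f : Ap p Ω} {M : ℝ} (hM : 0 ≤ M)
    (h : ∀ z ∈ closure (Ω : Set (Cn n)), ‖z‖ ≤ N → ‖f.derivExt α z‖ ≤ M) :
    apSeminorm p Ω α N f ≤ M :=
  Real.iSup_le (fun z => h z z.2.1 (by simpa using z.2.2)) hM

theorem norm_derivExt_sub_le (α : MultiIdx n p) (N : ℕ) (f g : Ap p Ω) {z : Cn n}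
    (hz : z ∈ closure (Ω : Set (Cn n))) (hN : ‖z‖ ≤ N) :
    ‖f.derivExt α z - g.derivExt α z‖ ≤ apSeminorm p Ω α N (f - g) := by
  have := (f - g).norm_derivExt_le α N hz hN
  rwa [derivExt_sub α f g hz] at this

instance : IsTopologicalAddGroup (Ap p Ω) := (apFamily_withSeminorms p Ω).topologicalAddGroup

instance : ContinuousSMul ℂ (Ap p Ω) := (apFamily_withSeminorms p Ω).continuousSMul

instance : FirstCountableTopology (Ap p Ω) :=
  (apFamily_withSeminorms p Ω).firstCountableTopology

theorem continuous_apSeminorm (α : MultiIdx n p) (N : ℕ) : Continuous (apSeminorm p Ω α N) :=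
  (apFamily_withSeminorms p Ω).continuous_seminorm (α, N)

theorem tendsto_toFun {f : Ap p Ω} (z : Ω) :
    Tendsto (fun g : Ap p Ω => g.toFun z) (𝓝 f) (𝓝 (f.toFun z)) := by
  obtain ⟨N, hN⟩ := exists_nat_ge ‖(z : Cn n)‖
  rw [tendsto_iff_norm_sub_tendsto_zero]
  have h : Tendsto (fun g => apSeminorm p Ω (MultiIdx.zero n p) N (g - f)) (𝓝 f) (𝓝 0) := by
    have : Continuous fun g => apSeminorm p Ω (MultiIdx.zero n p) N (g - f) :=
      (continuous_apSeminorm _ N).comp (continuous_id.sub continuous_const)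
    simpa using this.tendsto f
  refine squeeze_zero (fun _ => norm_nonneg _) (fun g => ?_) h
  rw [← derivExt_zero_apply, ← derivExt_zero_apply]
  exact norm_derivExt_sub_le _ N g f (subset_closure z.2) hN

/-- The element of `A^p(Ω)` with a given underlying function. -/
def mk (f : Ω → ℂ) (hf : f ∈ apSubmodule p Ω) : Ap p Ω := ⟨f, hf⟩

/-- The completeness of `A^p(Ω)`, in terms of seminorms. -/
theorem exists_le_nhds_of_cauchy {l : Filter (Ap p Ω)} [l.NeBot]
    (hl : ∀ α N, ∀ ε > 0, ∀ᶠ x in l ×ˢ l, apSeminorm p Ω α N (x.1 - x.2) < ε) :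
    ∃ f, l ≤ 𝓝 f := by
  have hlim : ∀ (α : MultiIdx n p) z, ∃ c, z ∈ closure (Ω : Set (Cn n)) →
      Tendsto (fun f : Ap p Ω => f.derivExt α z) l (𝓝 c) := by
    intro α z
    by_cases hz : z ∈ closure (Ω : Set (Cn n))
    swap
    · exact ⟨0, fun h => absurd h hz⟩
    obtain ⟨N, hN⟩ := exists_nat_ge ‖z‖
    have hc : Cauchy (l.map fun f : Ap p Ω => f.derivExt α z) := by
      refine ⟨inferInstance, ?_⟩
      rw [prod_map_map_eq]
      refine Metric.uniformity_basis_dist.ge_iff.2 fun ε hε => ?_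
      rw [mem_map]
      filter_upwards [hl α N ε hε] with x hx
      rw [mem_preimage, mem_ofPred_eq, dist_eq_norm]
      exact (norm_derivExt_sub_le α N x.1 x.2 hz hN).trans_lt hx
    obtain ⟨c, hc⟩ := CompleteSpace.complete hc
    exact ⟨c, fun _ => hc⟩
  choose G hG using hlim
  have hunif : ∀ (α : MultiIdx n p) (N : ℕ), ∀ ε > 0, ∀ᶠ f : Ap p Ω in l,
      ∀ z ∈ closure (Ω : Set (Cn n)), ‖z‖ ≤ N → ‖f.derivExt α z - G α z‖ ≤ ε := by
    intro α N ε hε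
    -- Fix `f` and let the second member of the Cauchy pair tend to its limit.
    filter_upwards [(hl α N ε hε).curry] with f hf z hz hN
    refine le_of_tendsto ((tendsto_const_nhds.sub (hG α z hz)).norm) ?_
    filter_upwards [hf] with g hg
    exact (norm_derivExt_sub_le α N f g hz hN).trans hg.le
  have hcont : ∀ α, ContinuousOn (G α) (closure (Ω : Set (Cn n))) := by
    intro α
    have : TendstoLocallyUniformlyOn (fun (f : Ap p Ω) => f.derivExt α) (G α) l
        (closure (Ω : Set (Cn n))) := by
      rw [Metric.tendstoLocallyUniformlyOn_iff]
      intro ε hε z _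
      obtain ⟨N, hN⟩ := exists_nat_ge (‖z‖ + 1)
      refine ⟨closure Ω ∩ ball z 1, inter_mem_nhdsWithin _ (ball_mem_nhds z one_pos), ?_⟩
      filter_upwards [hunif α N (ε / 2) (half_pos hε)] with f hf w hw
      rw [dist_comm, dist_eq_norm]
      refine (hf w hw.1 ?_).trans_lt (half_lt_self hε)
      have := norm_le_norm_add_norm_sub' w z
      have h2 := hw.2
      rw [mem_ball, dist_eq_norm] at h2
      linarith
    exact this.continuousOn (Eventually.of_forall fun f => f.derivExt_continuousOn α).frequently
  set o := MultiIdx.zero n p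
  -- Local bounds come from uniform closeness to the continuous function `G o`.
  have hLB : LocallyBoundedLimit l (fun f : Ap p Ω => zeroExt Ω f.toFun) (G o) Ω := by
    refine ⟨Eventually.of_forall fun f => f.2.1, fun z hz => ?_, fun z hz => ?_⟩
    · have hΩ : ∀ᶠ w in 𝓝 z, w ∈ Ω := Ω.isOpen.mem_nhds hz
      have hca : ContinuousAt (G o) z :=
        ((hcont o).mono subset_closure).continuousAt (Ω.isOpen.mem_nhds hz)
      have hev : ∀ᶠ w in 𝓝 z, ‖G o w‖ < ‖G o z‖ + 1 ∧ w ∈ Ω ∧ ‖w‖ < ‖z‖ + 1 :=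
        (hca.norm.eventually_lt_const (lt_add_one _)).and (hΩ.and
          (continuous_norm.continuousAt.eventually_lt_const (lt_add_one _)))
      obtain ⟨ρ, hρ, hball⟩ := Metric.eventually_nhds_iff_ball.1 hev
      obtain ⟨N, hN⟩ := exists_nat_ge (‖z‖ + 1)
      refine ⟨ρ, hρ, ‖G o z‖ + 1 + 1, ?_⟩
      filter_upwards [hunif o N 1 one_pos] with f hf w hw
      obtain ⟨h1, h2, h3⟩ := hball w hw
      have h4 := hf w (subset_closure h2) (h3.le.trans hN)
      rw [f.derivExt_zero_apply ⟨w, h2⟩, ← zeroExt_apply Ω f.toFun ⟨w, h2⟩] at h4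
      have := norm_le_norm_add_norm_sub' (zeroExt Ω f.toFun w) (G o w)
      simp only at h4
      linarith
    · refine (hG o z (subset_closure hz)).congr fun f => ?_
      rw [f.derivExt_zero_apply ⟨z, hz⟩, ← zeroExt_apply Ω f.toFun ⟨z, hz⟩]
  -- Both sides are limits of `∂^α f` on `Ω`, so the limit of the derivatives is the derivative of
  -- the limit.
  have hmulti : ∀ α : MultiIdx n p, EqOn (G α) (multiD α.1 (zeroExt Ω fun z => G o z)) Ω := by
    intro α z hz
    rw [multiD_eqOn Ω.isOpen α.1 (zeroExt_restrict_eqOn Ω (G o)) hz]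
    refine tendsto_nhds_unique (hG α z (subset_closure hz)) ?_
    refine ((hLB.multiD Ω.isOpen α.1).tendsto z hz).congr fun f => ?_
    exact (f.derivExt_eqOn α hz).symm
  have hmem : (fun z : Ω => G o z) ∈ apSubmodule p Ω := by
    refine ⟨fun z hz => ?_, fun α hα => ⟨G ⟨α, hα⟩, hcont _, hmulti ⟨α, hα⟩⟩⟩
    refine (hLB.analyticOnNhd Ω.isOpen z hz).congr ?_
    exact eventuallyEq_of_mem (Ω.isOpen.mem_nhds hz) (zeroExt_restrict_eqOn Ω (G o)).symm
  refine ⟨mk _ hmem, ?_⟩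
  refine ((apFamily_withSeminorms p Ω).tendsto_nhds id _).2 fun i ε hε => ?_
  filter_upwards [hunif i.1 i.2 (ε / 2) (half_pos hε)] with f hf
  refine (apSeminorm_le (half_pos hε).le fun z hz hN => ?_).trans_lt (half_lt_self hε)
  rw [id, derivExt_sub i.1 f (mk _ hmem) hz, Pi.sub_apply]
  have : derivExt i.1 (mk _ hmem) z = G i.1 z :=
    extendFrom_eqOn (hcont i.1) (hmulti i.1) hz
  rw [this]
  exact hf z hz hN

/-- Countably many seminorms give a countably generated uniformity; with completeness, Baire's
theorem applies. -/
instance : BaireSpace (Ap p Ω) := by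
  let : UniformSpace (Ap p Ω) := IsTopologicalAddGroup.rightUniformSpace (Ap p Ω)
  have : IsUniformAddGroup (Ap p Ω) := isUniformAddGroup_of_addCommGroup
  have : (uniformity (Ap p Ω)).IsCountablyGenerated :=
    IsUniformAddGroup.uniformity_countably_generated
  have : CompleteSpace (Ap p Ω) := ⟨fun {l} hl => by
    have := hl.1
    refine exists_le_nhds_of_cauchy fun α N ε hε => ?_
    have h := ((IsUniformAddGroup.cauchy_iff_tendsto l).1 hl).2
    have h' := ((continuous_apSeminorm (p := p) (Ω := Ω) α N).tendsto 0).comp h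
    rw [map_zero] at h'
    exact h'.eventually_lt_const hε⟩
  infer_instance

end Ap

/-! ### Closed sets with empty interior -/

/-- The `f ∈ A^p(Ω)` that agree, on the connected component of `x` in `B(c, r) ∩ Ω`, with a
holomorphic function on `B(c, r)` bounded by `M`. -/
def boundedlyExtendable (p : ℕ∞) (Ω : Opens (Cn n)) (c : Cn n) (r : ℝ) (x : Cn n) (M : ℝ) :
    Set (Ap p Ω) :=
  {f | ∃ F : Cn n → ℂ, AnalyticOnNhd ℂ F (ball c r) ∧ (∀ z ∈ ball c r, ‖F z‖ ≤ M) ∧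
    ∀ z : Ω, (z : Cn n) ∈ connectedComponentIn (ball c r ∩ (Ω : Set (Cn n))) x →
      F z = f.toFun z}

/-- A form of Montel's theorem. -/
theorem isClosed_boundedlyExtendable (c : Cn n) (r : ℝ) (x : Cn n) (M : ℝ) :
    IsClosed (boundedlyExtendable p Ω c r x M) := by
  rw [← closure_subset_iff_isClosed]
  intro f hf
  obtain ⟨u, hu, huf⟩ := mem_closure_iff_ultrafilter.1 hf
  have hex : ∀ g : Ap p Ω, ∃ F : Cn n → ℂ, g ∈ boundedlyExtendable p Ω c r x M →
      AnalyticOnNhd ℂ F (ball c r) ∧ (∀ z ∈ ball c r, ‖F z‖ ≤ M) ∧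
      ∀ z : Ω, (z : Cn n) ∈ connectedComponentIn (ball c r ∩ (Ω : Set (Cn n))) x →
        F z = g.toFun z := fun g => by
    by_cases hg : g ∈ boundedlyExtendable p Ω c r x M
    · obtain ⟨F, hF⟩ := hg
      exact ⟨F, fun _ => hF⟩
    · exact ⟨0, fun h => absurd h hg⟩
  choose Φ hΦ using hex
  -- The values of the chosen extensions stay in a compact disc, so they converge along the
  -- ultrafilter and keep the bound `M`.
  have hlim : ∀ z, ∃ a : ℂ, z ∈ ball c r →
      ‖a‖ ≤ M ∧ Tendsto (fun g => Φ g z) u (𝓝 a) := by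
    intro z
    by_cases hz : z ∈ ball c r
    swap
    · exact ⟨0, fun h => absurd h hz⟩
    obtain ⟨a, ha, ha'⟩ := (isCompact_closedBall (0 : ℂ) M).ultrafilter_le_nhds
      (u.map fun g => Φ g z) (by
        rw [le_principal_iff, Ultrafilter.mem_coe, Ultrafilter.mem_map]
        refine mem_of_superset hu fun g hg => ?_
        simpa using (hΦ g hg).2.1 z hz)
    exact ⟨a, fun _ => ⟨by simpa using ha, ha'⟩⟩
  choose F hF using hlim
  have hLB : LocallyBoundedLimit (u : Filter (Ap p Ω)) Φ F (ball c r) := by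
    refine ⟨mem_of_superset hu fun g hg => (hΦ g hg).1, fun z hz => ?_, fun z hz => (hF z hz).2⟩
    obtain ⟨ε, hε, hsub⟩ := Metric.isOpen_iff.1 isOpen_ball z hz
    exact ⟨ε, hε, M, mem_of_superset hu fun g hg w hw => (hΦ g hg).2.1 w (hsub hw)⟩
  refine ⟨F, hLB.analyticOnNhd isOpen_ball, fun z hz => (hF z hz).1, fun z hz => ?_⟩
  have hzb : (z : Cn n) ∈ ball c r := (connectedComponentIn_subset _ _ hz).1
  refine tendsto_nhds_unique ((hF z hzb).2) (((Ap.tendsto_toFun z).mono_left huf).congr' ?_)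
  exact mem_of_superset hu fun g hg => ((hΦ g hg).2.2 z hz).symm

theorem isOpen_connectedComponentIn_ball (c : Cn n) (r : ℝ) (x : Cn n) :
    IsOpen (connectedComponentIn (ball c r ∩ (Ω : Set (Cn n))) x) :=
  (isOpen_ball.inter Ω.isOpen).connectedComponentIn

/-- `1 / (⟨z, v⟩ - ⟨w, v⟩)` belongs to `A^p(Ω)` if the hyperplane on which its denominator
vanishes is disjoint from the closure of `Ω`. -/
theorem exists_mul_inner_sub_eq_one (p : ℕ∞) {w v : Cn n}
    (h : Disjoint (hyperplane w v) (closure (Ω : Set (Cn n)))) :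
    ∃ g : Ap p Ω, ∀ z : Ω, g.toFun z * (inner ℂ v (z : Cn n) - inner ℂ v w) = 1 := by
  set G : Cn n → ℂ := fun z => (inner ℂ v z - inner ℂ v w)⁻¹
  set U : Set (Cn n) := (hyperplane w v)ᶜ
  have hU : IsOpen U := by
    refine IsClosed.isOpen_compl (self := ?_)
    exact isClosed_eq (innerSL ℂ v).continuous continuous_const
  have hΩU : closure (Ω : Set (Cn n)) ⊆ U := fun z hz hz' => h.le_bot ⟨hz', hz⟩
  have hne : ∀ z ∈ U, inner ℂ v z - inner ℂ v w ≠ 0 := fun z hz => sub_ne_zero.2 hz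
  -- `U` is open and contains `closure Ω`, so all derivatives of `G` are continuous up to the
  -- boundary.
  have hG : AnalyticOnNhd ℂ G U := fun z hz =>
    (((innerSL ℂ v).analyticAt z).sub analyticAt_const).inv (hne z hz)
  have hmem : (fun z : Ω => G z) ∈ apSubmodule p Ω := by
    refine ⟨fun z hz => ?_, fun α _ => ⟨multiD α G, ?_, ?_⟩⟩
    · exact (hG z (hΩU (subset_closure hz))).congr
        (eventuallyEq_of_mem (Ω.isOpen.mem_nhds hz) (zeroExt_restrict_eqOn Ω G).symm)
    · exact ((GoodOp.multiD hU α).analytic G hG).continuousOn.mono hΩU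
    · exact (multiD_eqOn Ω.isOpen α (zeroExt_restrict_eqOn Ω G)).symm
  exact ⟨Ap.mk _ hmem, fun z => inv_mul_cancel₀ (hne z (hΩU (subset_closure z.2)))⟩

/-- By the identity theorem `F z * (⟨v, z⟩ - ⟨v, w⟩)` would be `1` on the whole ball, yet it
vanishes at `w`. -/
theorem not_extends_inv_inner_sub {w v c x : Cn n} {r : ℝ} (hw : w ∈ ball c r)
    (hx : x ∈ ball c r ∩ (Ω : Set (Cn n))) {g : Ap p Ω}
    (hg : ∀ z : Ω, g.toFun z * (inner ℂ v (z : Cn n) - inner ℂ v w) = 1) {F : Cn n → ℂ}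
    (hF : AnalyticOnNhd ℂ F (ball c r))
    (hFg : ∀ z : Ω, (z : Cn n) ∈ connectedComponentIn (ball c r ∩ (Ω : Set (Cn n))) x →
      F z = g.toFun z) : False := by
  have hP : AnalyticOnNhd ℂ (fun z => F z * (inner ℂ v z - inner ℂ v w)) (ball c r) := fun z hz =>
    (hF z hz).mul (((innerSL ℂ v).analyticAt z).sub analyticAt_const)
  have heq : EqOn (fun z => F z * (inner ℂ v z - inner ℂ v w)) (fun _ => 1) (ball c r) := by
    refine hP.eqOn_of_preconnected_of_eventuallyEq (fun _ _ => analyticAt_const)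
      (convex_ball c r).isPreconnected hx.1 ?_
    filter_upwards [(isOpen_connectedComponentIn_ball c r x).mem_nhds
      (mem_connectedComponentIn hx)] with z hz
    have hzΩ : z ∈ Ω := (connectedComponentIn_subset _ _ hz).2
    rw [hFg ⟨z, hzΩ⟩ hz, hg ⟨z, hzΩ⟩]
  simpa using heq hw

theorem interior_boundedlyExtendable_eq_empty (hΩ : StarCondition Ω) {c x : Cn n} {r : ℝ}
    (hc : (ball c r ∩ frontier (Ω : Set (Cn n))).Nonempty)
    (hx : x ∈ ball c r ∩ (Ω : Set (Cn n))) (M : ℝ) :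
    interior (boundedlyExtendable p Ω c r x M) = ∅ := by
  rw [eq_empty_iff_forall_notMem]
  intro f hf
  obtain ⟨ζ, hζ, hζΩ⟩ := hc
  obtain ⟨ε, hε, hsub⟩ := Metric.isOpen_iff.1 isOpen_ball ζ hζ
  obtain ⟨w, hw, -, v, -, hdisj⟩ := hΩ.2 ζ hζΩ ε hε
  obtain ⟨g, hg⟩ := exists_mul_inner_sub_eq_one p hdisj
  have hcont : Continuous fun t : ℂ => f + t • g := by fun_prop
  have hnear : ∀ᶠ t : ℂ in 𝓝 0, f + t • g ∈ boundedlyExtendable p Ω c r x M := by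
    have := hcont.tendsto 0
    rw [zero_smul, add_zero] at this
    exact this.eventually (mem_interior_iff_mem_nhds.1 hf)
  obtain ⟨t, ht, ht0⟩ := ((hnear.filter_mono nhdsWithin_le_nhds).and
    (self_mem_nhdsWithin : ∀ᶠ t : ℂ in 𝓝[≠] 0, t ∈ ({0}ᶜ : Set ℂ))).exists
  obtain ⟨F₀, hF₀, -, hF₀f⟩ := interior_subset hf
  obtain ⟨F₁, hF₁, -, hF₁f⟩ := ht
  -- The difference quotient of the extensions of `f + t • g` and `f` extends `g`.
  refine not_extends_inv_inner_sub (hsub hw) hx hg (F := fun z => t⁻¹ * (F₁ z - F₀ z))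
    (fun z hz => analyticAt_const.mul ((hF₁ z hz).sub (hF₀ z hz))) fun z hz => ?_
  have : (f + t • g).toFun z = f.toFun z + t * g.toFun z := rfl
  simp only [hF₀f z hz, hF₁f z hz, this, add_sub_cancel_left]
  exact inv_mul_cancel_left₀ ht0 _

/-- A countable family of nowhere dense closed conditions defines a dense `G_δ` set. -/
theorem isGδ_and_dense_compl_iUnion (hΩ : StarCondition Ω) {ι : Type*} [Countable ι]
    (c : ι → Cn n) (r : ι → ℝ) (x : ι → Cn n) (M : ι → ℝ)
    (hc : ∀ i, (ball (c i) (r i) ∩ frontier (Ω : Set (Cn n))).Nonempty)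
    (hx : ∀ i, x i ∈ ball (c i) (r i) ∩ (Ω : Set (Cn n))) :
    IsGδ (⋃ i, boundedlyExtendable p Ω (c i) (r i) (x i) (M i))ᶜ ∧
      Dense (⋃ i, boundedlyExtendable p Ω (c i) (r i) (x i) (M i))ᶜ := by
  rw [compl_iUnion]
  refine ⟨IsGδ.iInter_of_isOpen fun i => (isClosed_boundedlyExtendable _ _ _ _).isOpen_compl,
    dense_iInter_of_isOpen (fun i => (isClosed_boundedlyExtendable _ _ _ _).isOpen_compl)
      fun i => ?_⟩
  rw [← interior_eq_empty_iff_dense_compl]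
  exact interior_boundedlyExtendable_eq_empty hΩ (hc i) (hx i) (M i)

/-! ### Components of `B(c, r) ∩ Ω` and reduction to countable data -/

/-- A connected component of `B(c, r) ∩ Ω` accumulates at a boundary point of `Ω` in `B(c, r)`,
provided that the ball is not contained in `Ω`. -/
theorem exists_mem_frontier_inter_closure_component {c x ζ : Cn n} {r : ℝ}
    (hx : x ∈ ball c r ∩ (Ω : Set (Cn n))) (hζ : ζ ∈ ball c r) (hζΩ : ζ ∉ Ω) :
    ∃ η ∈ ball c r, η ∈ frontier (Ω : Set (Cn n)) ∧
      η ∈ closure (connectedComponentIn (ball c r ∩ (Ω : Set (Cn n))) x) := by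
  set C := connectedComponentIn (ball c r ∩ (Ω : Set (Cn n))) x
  have hCo : IsOpen C := isOpen_connectedComponentIn_ball c r x
  have hCs : C ⊆ ball c r ∩ (Ω : Set (Cn n)) := connectedComponentIn_subset _ _
  -- Otherwise `C` would be open and closed in the connected ball, hence contain `ζ`.
  obtain ⟨η, ⟨hηcl, hη⟩, hηC⟩ : ∃ η ∈ closure C ∩ ball c r, η ∉ C := by
    by_contra! hcon
    exact hζΩ (hCs ((convex_ball c r).isPreconnected.subset_of_closure_inter_subset hCo
      ⟨x, hx.1, mem_connectedComponentIn hx⟩ hcon hζ)).2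
  refine ⟨η, hη, ⟨closure_mono (hCs.trans inter_subset_right) hηcl, fun hηΩ => ?_⟩, hηcl⟩
  rw [Ω.isOpen.interior_eq] at hηΩ
  -- If `η` were in `Ω`, its open component would meet `C`, hence equal `C`.
  obtain ⟨y, hyD, hyC⟩ := mem_closure_iff.1 hηcl _ (isOpen_connectedComponentIn_ball (Ω := Ω) c r η)
    (mem_connectedComponentIn ⟨hη, hηΩ⟩)
  have h1 := connectedComponentIn_eq hyD
  have h2 := connectedComponentIn_eq hyC
  refine hηC ?_
  change η ∈ connectedComponentIn _ x
  rw [h2, ← h1]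
  exact mem_connectedComponentIn ⟨hη, hηΩ⟩

theorem connectedComponentIn_ball_subset {c q x y : Cn n} {r s : ℝ} (hsub : ball q s ⊆ ball c r)
    (hyC : y ∈ connectedComponentIn (ball c r ∩ (Ω : Set (Cn n))) x) :
    connectedComponentIn (ball q s ∩ (Ω : Set (Cn n))) y ⊆
      connectedComponentIn (ball c r ∩ (Ω : Set (Cn n))) x := by
  rw [connectedComponentIn_eq hyC]
  exact connectedComponentIn_mono y (inter_subset_inter_left _ hsub)

/-- Compactness of the smaller closed ball bounds `F`; the component of `y`, being open, contains a
term of the dense sequence. -/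
theorem exists_mem_boundedlyExtendable {f : Ap p Ω} {F : Cn n → ℂ} {c q x y : Cn n} {r s : ℝ}
    (hF : AnalyticOnNhd ℂ F (ball c r))
    (hFf : ∀ z : Ω, (z : Cn n) ∈ connectedComponentIn (ball c r ∩ (Ω : Set (Cn n))) x →
      F z = f.toFun z)
    (hsub : closedBall q s ⊆ ball c r) (hy : y ∈ ball q s)
    (hyC : y ∈ connectedComponentIn (ball c r ∩ (Ω : Set (Cn n))) x) :
    ∃ k M : ℕ, denseSeq (Cn n) k ∈ ball q s ∩ (Ω : Set (Cn n)) ∧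
      f ∈ boundedlyExtendable p Ω q s (denseSeq (Cn n) k) M := by
  have hyΩ : y ∈ ball q s ∩ (Ω : Set (Cn n)) := ⟨hy, (connectedComponentIn_subset _ _ hyC).2⟩
  obtain ⟨k, hk⟩ := (denseRange_denseSeq (Cn n)).exists_mem_open
    (isOpen_connectedComponentIn_ball (Ω := Ω) q s y) ⟨y, mem_connectedComponentIn hyΩ⟩
  obtain ⟨B, hB⟩ := (isCompact_closedBall q s).exists_bound_of_continuousOn
    (hF.continuousOn.mono hsub)
  obtain ⟨M, hM⟩ := exists_nat_ge B
  refine ⟨k, M, connectedComponentIn_subset _ _ hk, F, hF.mono (ball_subset_closedBall.trans hsub),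
    fun z hz => (hB z (ball_subset_closedBall hz)).trans hM, fun z hz => hFf z ?_⟩
  rw [← connectedComponentIn_eq hk] at hz
  exact connectedComponentIn_ball_subset (ball_subset_closedBall.trans hsub) hyC hz

/-! ### The two dense `G_δ` sets -/

theorem nonExtendableAt_isGδ_and_dense (hΩ : StarCondition Ω) {ζ : Cn n}
    (hζ : ζ ∈ frontier (Ω : Set (Cn n))) :
    IsGδ (nonExtendableAt p Ω ζ) ∧ Dense (nonExtendableAt p Ω ζ) := by
  let ι := {i : ℚ × ℕ × ℕ // denseSeq (Cn n) i.2.1 ∈ ball ζ (i.1 : ℝ) ∩ (Ω : Set (Cn n))}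
  have key : nonExtendableAt p Ω ζ = (⋃ i : ι, boundedlyExtendable p Ω ζ (i.1.1 : ℝ)
      (denseSeq (Cn n) i.1.2.1) i.1.2.2)ᶜ := by
    ext f
    rw [nonExtendableAt, mem_ofPred_eq, mem_compl_iff, not_iff_not, mem_iUnion]
    constructor
    · rintro ⟨r, -, F, hF, x, hx, hFf⟩
      -- The smaller ball must still contain `x`.
      obtain ⟨s, hs, hsr⟩ := exists_rat_btwn (mem_ball.1 hx.1)
      obtain ⟨k, M, hk, hmem⟩ := exists_mem_boundedlyExtendable hF hFf
        (closedBall_subset_ball hsr) (mem_ball.2 hs) (mem_connectedComponentIn hx)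
      exact ⟨⟨(s, k, M), hk⟩, hmem⟩
    · rintro ⟨⟨⟨s, k, M⟩, hk⟩, F, hF, -, hFf⟩
      exact ⟨s, pos_of_mem_ball hk.1, F, hF, _, hk, hFf⟩
  rw [key]
  exact isGδ_and_dense_compl_iUnion hΩ (fun _ => ζ) _ _ _
    (fun i => ⟨ζ, mem_ball_self (pos_of_mem_ball i.2.1), hζ⟩) fun i => i.2

/-- Centres must now be countable too, so they leave `∂Ω`. A component need not accumulate at the
given boundary point; both inclusions pass to a boundary point `η` in its closure. -/
theorem nonExtendable_isGδ_and_dense (hΩ : StarCondition Ω) :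
    IsGδ (nonExtendable p Ω) ∧ Dense (nonExtendable p Ω) := by
  let ι := {i : ℕ × ℚ × ℕ × ℕ //
    (ball (denseSeq (Cn n) i.1) (i.2.1 : ℝ) ∩ frontier (Ω : Set (Cn n))).Nonempty ∧
      denseSeq (Cn n) i.2.2.1 ∈ ball (denseSeq (Cn n) i.1) (i.2.1 : ℝ) ∩ (Ω : Set (Cn n))}
  have hnot : ∀ {η}, η ∈ frontier (Ω : Set (Cn n)) → η ∉ Ω := fun hη h =>
    hη.2 (by rwa [Ω.isOpen.interior_eq])
  have key : nonExtendable p Ω = (⋃ i : ι, boundedlyExtendable p Ω (denseSeq (Cn n) i.1.1)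
      (i.1.2.1 : ℝ) (denseSeq (Cn n) i.1.2.2.1) i.1.2.2.2)ᶜ := by
    ext f
    rw [nonExtendable, mem_ofPred_eq, mem_compl_iff, ← not_iff_not, not_not, mem_iUnion]
    push Not
    constructor
    · rintro ⟨ζ, hζ, r, hr, F, hF, x, hx, hFf⟩
      obtain ⟨η, hη, hηΩ, hηC⟩ := exists_mem_frontier_inter_closure_component hx
        (mem_ball_self hr) (hnot hζ)
      -- Half the gap: the new centre is within `s` of `η`, and `dist η ζ + 2s < r` puts its closed
      -- ball inside `ball ζ r`.
      obtain ⟨s, hs0, hs⟩ := exists_rat_btwn (show (0 : ℝ) < (r - dist η ζ) / 2 by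
        rw [mem_ball] at hη; linarith)
      obtain ⟨j, hj⟩ := (denseRange_denseSeq (Cn n)).exists_dist_lt η hs0
      have hηs : η ∈ ball (denseSeq (Cn n) j) (s : ℝ) := hj
      have hsub : closedBall (denseSeq (Cn n) j) (s : ℝ) ⊆ ball ζ r := by
        refine closedBall_subset_ball' ?_
        have := dist_triangle_left (denseSeq (Cn n) j) ζ η
        linarith
      obtain ⟨y, hy, hyC⟩ := mem_closure_iff.1 hηC _ isOpen_ball hηs
      obtain ⟨k, M, hk, hmem⟩ := exists_mem_boundedlyExtendable hF hFf hsub hy hyC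
      exact ⟨⟨(j, s, k, M), ⟨η, hηs, hηΩ⟩, hk⟩, hmem⟩
    · rintro ⟨⟨⟨j, s, k, M⟩, ⟨ζ, hζ, hζΩ⟩, hk⟩, F, hF, -, hFf⟩
      obtain ⟨η, hη, hηΩ, hηC⟩ := exists_mem_frontier_inter_closure_component hk hζ (hnot hζΩ)
      obtain ⟨ε, hε, hsub⟩ := Metric.isOpen_iff.1 isOpen_ball η hη
      obtain ⟨y, hy, hyC⟩ := mem_closure_iff.1 hηC _ isOpen_ball (mem_ball_self hε)
      exact ⟨η, hηΩ, ε, hε, F, hF.mono hsub, y, ⟨hy, (connectedComponentIn_subset _ _ hyC).2⟩,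
        fun z hz => hFf z (connectedComponentIn_ball_subset hsub hyC hz)⟩
  rw [key]
  exact isGδ_and_dense_compl_iUnion hΩ _ _ _ _ (fun i => i.2.1) fun i => i.2.2

/-! ### Convex sets -/

theorem starCondition_of_convex (h : Convex ℝ (Ω : Set (Cn n))) : StarCondition Ω := by
  refine ⟨h.isPreconnected, fun ζ hζ ε hε => ?_⟩
  have hne : (interior (Ω : Set (Cn n))).Nonempty := by
    rw [Ω.isOpen.interior_eq]
    exact closure_nonempty_iff.1 ⟨ζ, hζ.1⟩
  -- An open convex set is the interior of its closure, so points outside the closure lie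
  -- arbitrarily near `ζ`.
  have hζ' : ζ ∉ interior (closure (Ω : Set (Cn n))) := by
    rw [h.interior_closure_eq_interior_of_nonempty_interior hne]
    exact hζ.2
  obtain ⟨w, hw, hwΩ⟩ : ∃ w ∈ ball ζ ε, w ∉ closure (Ω : Set (Cn n)) := by
    by_contra! hcon
    exact hζ' (mem_interior.2 ⟨ball ζ ε, hcon, isOpen_ball, mem_ball_self hε⟩)
  -- Separating real parts of a complex functional makes `f z ≠ f w` on the closure; Riesz
  -- represents `f` by `v`.
  obtain ⟨f, u, hfu, huw⟩ := RCLike.geometric_hahn_banach_closed_point (𝕜 := ℂ) h.closure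
    isClosed_closure hwΩ
  set v := (InnerProductSpace.toDual ℂ (Cn n)).symm f
  have hv : ∀ z, inner ℂ v z = f z := fun z => InnerProductSpace.toDual_symm_apply
  have hsep : ∀ z ∈ closure (Ω : Set (Cn n)), f z ≠ f w := fun z hz hzw => by
    have := (hfu z hz).trans huw
    rw [hzw] at this
    exact this.false
  refine ⟨w, hw, hwΩ, v, fun hv0 => ?_, ?_⟩
  · refine hsep ζ hζ.1 ?_
    rw [← hv, ← hv, hv0, inner_zero_left, inner_zero_left]
  · refine disjoint_left.2 fun z hz hz' => hsep z hz' ?_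
    rw [← hv, ← hv]
    exact hz

end HolExt

end

theorem theorem4 (n : ℕ) (p : ℕ∞) (Ω : TopologicalSpace.Opens (HolExt.Cn n)) :
    (HolExt.StarCondition Ω →
      (∀ ζ ∈ frontier (Ω : Set (HolExt.Cn n)),
        IsGδ (HolExt.nonExtendableAt p Ω ζ) ∧ Dense (HolExt.nonExtendableAt p Ω ζ)) ∧
      (IsGδ (HolExt.nonExtendable p Ω) ∧ Dense (HolExt.nonExtendable p Ω))) ∧
    (Convex ℝ (Ω : Set (HolExt.Cn n)) →
      (∀ ζ ∈ frontier (Ω : Set (HolExt.Cn n)),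
        IsGδ (HolExt.nonExtendableAt p Ω ζ) ∧ Dense (HolExt.nonExtendableAt p Ω ζ)) ∧
      (IsGδ (HolExt.nonExtendable p Ω) ∧ Dense (HolExt.nonExtendable p Ω))) := by
  have main : HolExt.StarCondition Ω →
      (∀ ζ ∈ frontier (Ω : Set (HolExt.Cn n)),
        IsGδ (HolExt.nonExtendableAt p Ω ζ) ∧ Dense (HolExt.nonExtendableAt p Ω ζ)) ∧
      (IsGδ (HolExt.nonExtendable p Ω) ∧ Dense (HolExt.nonExtendable p Ω)) := fun hΩ =>
    ⟨fun _ hζ => HolExt.nonExtendableAt_isGδ_and_dense hΩ hζ,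
      HolExt.nonExtendable_isGδ_and_dense hΩ⟩
  exact ⟨main, fun h => main (HolExt.starCondition_of_convex h)⟩
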